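/- Let $n\ge 0$, $g_1,\dots,g_n>0$, $0<\xi_1<\dots<\xi_n\le 1$ and $g=\sum_{i=1}^n g_i\delta_{\xi_i}$. Differential equations below hold in the sense of distributions for continuous complex-valued functions, the string being continued without mass outside $[0,1]$; derivatives at $\xi=0$ and $\xi=1$ are right-hand derivatives (this matters only at $1$, when $\xi_n=1$). Put $(f,h)_g=\int_{[0,1]} f h\,dg=\sum_i g_i f(\xi_i)h(\xi_i)$ on $L^2_g$. For $a=0,1,2$ the *cubic string problem of Type $a$* is $$-\phi_{\xi\xi\xi}=z\,g\,\phi,\qquad \phi(0)=\phi_\xi(0)=0,\qquad \text{with } \phi(1)=0\ (a=0),\quad \phi_\xi(1)=0\ (a=1),\quad \phi_{\xi\xi}(1)=0\ (a=2),$$ and the *adjoint problem of Type $a$* is $$\phi^*_{\xi\xi\xi}=z\,g\,\phi^*,\qquad \phi^*(0)=0,\qquad \text{with } \phi^*(1)=\phi^*_\xi(1)=0\ (a=0),\quad \phi^*(1)=\phi^*_{\xi\xi}(1)=0\ (a=1),\quad \phi^*_\xi(1)=\phi^*_{\xi\xi}(1)=0\ (a=2).$$ The spectrum is the set of $z\in\mathbb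 C$ for which there is a solution that does not vanish identically on $[0,1]$ (an eigenfunction). For every $z\in\mathbb C$ the equation $-\phi_{\xi\xi\xi}=zg\phi$ has a unique solution $\phi(\xi;z)$ with $\phi(0)=\phi_\xi(0)=0$, $\phi_{\xi\xi}(0)=1$, and for each $a$ the equation $\phi^*_{\xi\xi\xi}=zg\phi^*$ has a unique solution $\phi_a^*(\xi;z)$ for which, among $\phi^*(1),\phi^*_\xi(1),\phi^*_{\xi\xi}(1)$, the value $\phi^*_{\xi\xi}(1)$ (if $a=0$), $\phi^*_{\xi}(1)$ (if $a=1$), $\phi^*(1)$ (if $a=2$) is $1$ and the other two are $0$. Moreover, for each $a=0,1,2$: 1. The adjoint problem of Type $a$ and the cubic string problem of Type $a$ have the same spectrum; denote its distinct elements by $z_{a,j}$. The functions $\phi_{a,j}=\phi(\cdot;z_{a,j})$ and $\phi^*_{a,j}=\phi^*_a(\cdot;z_{a,j})$ are eigenfunctions of the cubic string problem and of the adjoint problem of Type $a$, respectively. 2. $(\phi_{a,i},\phi^*_{a,j})_g=0$ whenever $i\ne j$. 3. For $i=j$, $$(\phi_{a,i},\phi^*_{a,i})_g=\begin{cases}-\phi_z(1;z_{0,i})\neq0,&a=0,\\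 \phi_{\xi z}(1;z_{1,i})\neq0,&a=1,\\ -\phi_{\xi\xi z}(1;z_{2,i})\neq0,&a=2.\end{cases}$$ -/

import Mathlib

open MeasureTheory
open scoped ContDiff

namespace CubicString

/-- The discrete mass distribution `g = ∑ i, m i • δ_{x i}`, as a measure on `ℝ`. -/
noncomputable def massMeasure {n : ℕ} (x m : Fin n → ℝ) : Measure ℝ :=
  ∑ i, ENNReal.ofReal (m i) • Measure.dirac (x i)

/-- `u''' = c g u` in the sense of distributions, for a continuous function `u`.
Functions live on the whole line: the string is continued without mass beyond its two ends,
so that right-hand boundary values make sense even if a mass sits at the end point `1`. -/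
def ThirdDerivEq (g : Measure ℝ) (c : ℂ) (u : ℝ → ℂ) : Prop :=
  Continuous u ∧
    ∀ ψ : ℝ → ℂ, ContDiff ℝ ∞ ψ → HasCompactSupport ψ →
      -∫ ξ, u ξ * iteratedDeriv 3 ψ ξ = c * ∫ ξ, u ξ * ψ ξ ∂g

/-- The cubic string equation `-φ''' = z g φ`. -/
def IsSolution (g : Measure ℝ) (z : ℂ) (φ : ℝ → ℂ) : Prop :=
  ThirdDerivEq g (-z) φ

/-- The adjoint cubic string equation `φ*''' = z g φ*`. -/
def IsAdjointSolution (g : Measure ℝ) (z : ℂ) (φ : ℝ → ℂ) : Prop :=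
  ThirdDerivEq g z φ

/-- The `k`-th right-hand derivative of `u` at the point `p`. -/
noncomputable def rightDeriv (k : ℕ) (u : ℝ → ℂ) (p : ℝ) : ℂ :=
  iteratedDerivWithin k u (Set.Ici p) p

/-- Initial value problem `φ(0) = φ'(0) = 0`, `φ''(0) = 1` for the cubic string. -/
def IsIVPSolution (g : Measure ℝ) (z : ℂ) (φ : ℝ → ℂ) : Prop :=
  IsSolution g z φ ∧ φ 0 = 0 ∧ rightDeriv 1 φ 0 = 0 ∧ rightDeriv 2 φ 0 = 1

/-- Initial conditions at `1` for the adjoint cubic string of Type `a`. -/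
def AdjointInitialCondition (a : Fin 3) (φ : ℝ → ℂ) : Prop :=
  match a with
  | 0 => φ 1 = 0 ∧ rightDeriv 1 φ 1 = 0 ∧ rightDeriv 2 φ 1 = 1
  | 1 => φ 1 = 0 ∧ rightDeriv 1 φ 1 = 1 ∧ rightDeriv 2 φ 1 = 0
  | 2 => φ 1 = 1 ∧ rightDeriv 1 φ 1 = 0 ∧ rightDeriv 2 φ 1 = 0

/-- Initial value problem of Type `a` for the adjoint cubic string. -/
def IsAdjointIVPSolution (g : Measure ℝ) (a : Fin 3) (z : ℂ) (φ : ℝ → ℂ) : Prop :=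
  IsAdjointSolution g z φ ∧ AdjointInitialCondition a φ

/-- Boundary conditions of Type `a` for the cubic string. -/
def BoundaryCondition (a : Fin 3) (φ : ℝ → ℂ) : Prop :=
  φ 0 = 0 ∧ rightDeriv 1 φ 0 = 0 ∧
    match a with
    | 0 => φ 1 = 0
    | 1 => rightDeriv 1 φ 1 = 0
    | 2 => rightDeriv 2 φ 1 = 0

/-- Boundary conditions of Type `a` for the adjoint cubic string. -/
def AdjointBoundaryCondition (a : Fin 3) (φ : ℝ → ℂ) : Prop :=
  φ 0 = 0 ∧
    match a with
    | 0 => φ 1 = 0 ∧ rightDeriv 1 φ 1 = 0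
    | 1 => φ 1 = 0 ∧ rightDeriv 2 φ 1 = 0
    | 2 => rightDeriv 1 φ 1 = 0 ∧ rightDeriv 2 φ 1 = 0

/-- `φ` is an eigenfunction of the Type `a` boundary value problem with eigenvalue `z`. -/
def IsEigenfunction (g : Measure ℝ) (a : Fin 3) (z : ℂ) (φ : ℝ → ℂ) : Prop :=
  IsSolution g z φ ∧ BoundaryCondition a φ ∧ ∃ ξ ∈ Set.Icc (0 : ℝ) 1, φ ξ ≠ 0

/-- `φ` is an eigenfunction of the adjoint Type `a` problem with eigenvalue `z`. -/
def IsAdjointEigenfunction (g : Measure ℝ) (a : Fin 3) (z : ℂ) (φ : ℝ → ℂ) : Prop :=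
  IsAdjointSolution g z φ ∧ AdjointBoundaryCondition a φ ∧ ∃ ξ ∈ Set.Icc (0 : ℝ) 1, φ ξ ≠ 0

/-- The spectrum of the cubic string boundary value problem of Type `a`. -/
def spectrum (g : Measure ℝ) (a : Fin 3) : Set ℂ :=
  {z | ∃ φ, IsEigenfunction g a z φ}

/-- The spectrum of the adjoint cubic string boundary value problem of Type `a`. -/
def adjointSpectrum (g : Measure ℝ) (a : Fin 3) : Set ℂ :=
  {z | ∃ φ, IsAdjointEigenfunction g a z φ}

/-- The bilinear pairing `(f, h)_g = ∫₀¹ f h dg` on `L²[0,1]_g`; a mass at `1` counts. -/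
noncomputable def pairing (g : Measure ℝ) (f h : ℝ → ℂ) : ℂ :=
  ∫ ξ in Set.Icc (0 : ℝ) 1, f ξ * h ξ ∂g

end CubicString

/-! A continuous `u` solves `u''' = c g u` exactly when it is a quadratic polynomial plus `c` times
the sum of `m i * u (x i)` times the truncated quadratic `(t - x i)₊² / 2`. The values at the nodes
then satisfy a strictly triangular linear system, which gives existence, uniqueness and
differentiability in `z`. Truncating on the other side of the nodes exchanges data at `0` for data
at `1`.

Items 1 and 2, and the formulas of item 3, come from one Lagrange identity, `sub_mul_pairing`: `(w -
z) (φ(·;z), φ*_a(·;w))_g = (-1)^a b_a(φ(·;z)) - φ*_a(0;w)`, where `b_a` is the `a`-th right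
derivative at `1`. Taking `w = z` shows that both boundary values vanish together. Taking two
distinct eigenvalues gives orthogonality. For fixed `w`, the difference quotient of `(-1)^a b_a`
between `z` and `w` is minus the pairing, and `z → w` gives the diagonal formulas.

There remains the simplicity of the zeros of `z ↦ b_a(φ(·;z))`. Put `s = -z` and follow `(p, q, r) =
(φ, φ', φ'')`. For `Im s > 0`, a system of six inequalities (`PosState`) is preserved by massless
intervals and by the jumps `r ↦ r + m s p`. It forces `p, q, r ≠ 0` at `1`, so there are no nonreal
zeros (`Im s < 0` by conjugation). The same algebra over the dual numbers, with `s = -z + ε` and `z`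
real, says that value and derivative do not vanish together. The parameter `κ` treats both cases at
once. -/

namespace CubicString

open Filter Topology

/-! ### Integration by parts against test functions -/

section TestFunctions

theorem hasDerivAt_iteratedDeriv {E : Type*} [NormedAddCommGroup E] [NormedSpace ℝ E]
    {ψ : ℝ → E} (hψ : ContDiff ℝ ∞ ψ) (k : ℕ) (t : ℝ) :
    HasDerivAt (iteratedDeriv k ψ) (iteratedDeriv (k + 1) ψ t) t := by
  rw [iteratedDeriv_succ]
  exact ((hψ.differentiable_iteratedDeriv k (by exact_mod_cast ENat.natCast_lt_top k)) t).hasDerivAt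

theorem contDiff_iteratedDeriv {E : Type*} [NormedAddCommGroup E] [NormedSpace ℝ E]
    {ψ : ℝ → E} (hψ : ContDiff ℝ ∞ ψ) (k : ℕ) : ContDiff ℝ ∞ (iteratedDeriv k ψ) := by
  induction k with
  | zero => simpa using hψ
  | succ k ih =>
    rw [iteratedDeriv_succ]
    exact ((contDiff_infty_iff_deriv).1 ih).2

theorem hasCompactSupport_iteratedDeriv {E : Type*} [NormedAddCommGroup E] [NormedSpace ℝ E]
    {ψ : ℝ → E} (hψ : HasCompactSupport ψ) (k : ℕ) : HasCompactSupport (iteratedDeriv k ψ) := by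
  induction k with
  | zero => simpa using hψ
  | succ k ih =>
    rw [iteratedDeriv_succ]
    exact ih.deriv

/-- The boundary term when a quadratic polynomial is moved off a third derivative. -/
noncomputable def byParts (A B C : ℂ) (ψ : ℝ → ℂ) (t : ℝ) : ℂ :=
  (A + B * t + C * t ^ 2) * iteratedDeriv 2 ψ t - (B + 2 * C * t) * iteratedDeriv 1 ψ t
    + 2 * C * iteratedDeriv 0 ψ t

theorem hasDerivAt_byParts (A B C : ℂ) {ψ : ℝ → ℂ} (hψ : ContDiff ℝ ∞ ψ) (t : ℝ) :
    HasDerivAt (byParts A B C ψ) ((A + B * t + C * t ^ 2) * iteratedDeriv 3 ψ t) t := by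
  have hid : HasDerivAt (fun s : ℝ => (s : ℂ)) 1 t := Complex.ofRealCLM.hasDerivAt
  have h1 : HasDerivAt (fun s : ℝ => A + B * (s : ℂ) + C * (s : ℂ) ^ 2) (B + 2 * C * t) t := by
    have := ((hid.const_mul B).const_add A).add ((hid.pow 2).const_mul C)
    refine this.congr_deriv ?_
    push_cast; ring
  have h2 : HasDerivAt (fun s : ℝ => B + 2 * C * (s : ℂ)) (2 * C) t := by
    have := (hid.const_mul (2 * C)).const_add B
    refine this.congr_deriv ?_
    ring
  have := ((h1.mul (hasDerivAt_iteratedDeriv hψ 2 t)).sub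
    (h2.mul (hasDerivAt_iteratedDeriv hψ 1 t))).add
      ((hasDerivAt_iteratedDeriv hψ 0 t).const_mul (2 * C))
  refine this.congr_deriv ?_
  simp only [Nat.reduceAdd]
  ring

theorem contDiff_byParts (A B C : ℂ) {ψ : ℝ → ℂ} (hψ : ContDiff ℝ ∞ ψ) :
    ContDiff ℝ ∞ (byParts A B C ψ) := by
  have hid : ContDiff ℝ ∞ (fun s : ℝ => (s : ℂ)) := Complex.ofRealCLM.contDiff
  have h0 := contDiff_iteratedDeriv hψ 0
  have h1 := contDiff_iteratedDeriv hψ 1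
  have h2 := contDiff_iteratedDeriv hψ 2
  unfold byParts
  fun_prop

theorem hasCompactSupport_byParts (A B C : ℂ) {ψ : ℝ → ℂ} (hψ : HasCompactSupport ψ) :
    HasCompactSupport (byParts A B C ψ) := by
  have h0 := (hasCompactSupport_iteratedDeriv hψ 0).mul_left (f := fun _ : ℝ => 2 * C)
  have h1 := (hasCompactSupport_iteratedDeriv hψ 1).mul_left
    (f := fun t : ℝ => -(B + 2 * C * t))
  have h2 := (hasCompactSupport_iteratedDeriv hψ 2).mul_left
    (f := fun t : ℝ => A + B * t + C * t ^ 2)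
  have e : byParts A B C ψ = (fun t : ℝ => A + B * (t : ℂ) + C * (t : ℂ) ^ 2) *
      iteratedDeriv 2 ψ + (fun t : ℝ => -(B + 2 * C * (t : ℂ))) * iteratedDeriv 1 ψ +
      (fun _ : ℝ => 2 * C) * iteratedDeriv 0 ψ := by
    ext t
    simp only [byParts, Pi.add_apply, Pi.mul_apply]
    ring
  rw [e]
  exact (h2.add h1).add h0

theorem integral_quadratic_mul_iteratedDeriv (A B C : ℂ) {ψ : ℝ → ℂ} (hψ : ContDiff ℝ ∞ ψ)
    (hc : HasCompactSupport ψ) :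
    ∫ t : ℝ, (A + B * t + C * t ^ 2) * iteratedDeriv 3 ψ t = 0 := by
  have hF := contDiff_byParts A B C hψ
  have hFc := hasCompactSupport_byParts A B C hc
  refine integral_eq_zero_of_hasDerivAt_of_integrable (hasDerivAt_byParts A B C hψ) ?_
    (hF.continuous.integrable_of_hasCompactSupport hFc)
  refine Continuous.integrable_of_hasCompactSupport ?_
    (hasCompactSupport_iteratedDeriv hc 3).mul_left
  have := (contDiff_iteratedDeriv hψ 3).continuous
  fun_prop

theorem integral_Ioi_quadratic_mul_iteratedDeriv (A B C : ℂ) {ψ : ℝ → ℂ} (hψ : ContDiff ℝ ∞ ψ)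
    (hc : HasCompactSupport ψ) (b : ℝ) :
    ∫ t in Set.Ioi b, (A + B * t + C * t ^ 2) * iteratedDeriv 3 ψ t = - byParts A B C ψ b := by
  rw [← (hasCompactSupport_byParts A B C hc).integral_Ioi_deriv_eq
    ((contDiff_byParts A B C hψ).of_le (by exact_mod_cast le_top)) b]
  congr 1
  ext t
  exact (hasDerivAt_byParts A B C hψ t).deriv.symm

end TestFunctions

/-! ### The fundamental solution, and functions with zero third distributional derivative -/

/-- The truncated quadratic `max(t, 0)² / 2`, the causal fundamental solution of `d³/dt³`. -/
noncomputable def ker (t : ℝ) : ℂ := (((max t 0) ^ 2 / 2 : ℝ) : ℂ)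

theorem ker_of_nonneg {t : ℝ} (ht : 0 ≤ t) : ker t = (t : ℂ) ^ 2 / 2 := by
  simp [ker, max_eq_left ht]

theorem ker_of_nonpos {t : ℝ} (ht : t ≤ 0) : ker t = 0 := by
  simp [ker, max_eq_right ht]

/-- Causal and anticausal fundamental solutions differ by a polynomial; this is what allows data at
`0` to be traded for data at `1`. -/
theorem ker_eq_sub (t : ℝ) : ker t = (t : ℂ) ^ 2 / 2 - ker (-t) := by
  rcases le_total 0 t with h | h
  · rw [ker_of_nonneg h, ker_of_nonpos (neg_nonpos.2 h)]; ring
  · rw [ker_of_nonpos h, ker_of_nonneg (neg_nonneg.2 h)]; push_cast; ring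

@[fun_prop]
theorem continuous_ker : Continuous ker := by
  unfold ker
  fun_prop

/-- On `(a, ∞)` the kernel is `(t - a)² / 2`. It vanishes to second order at `a`, so only the last
boundary term of `byParts` survives. -/
theorem integral_ker_mul_iteratedDeriv {ψ : ℝ → ℂ} (hψ : ContDiff ℝ ∞ ψ)
    (hc : HasCompactSupport ψ) (a : ℝ) :
    ∫ t : ℝ, ker (t - a) * iteratedDeriv 3 ψ t = - ψ a := by
  rw [← setIntegral_eq_integral_of_forall_compl_eq_zero (s := Set.Ioi a)]
  · have h := integral_Ioi_quadratic_mul_iteratedDeriv ((a : ℂ) ^ 2 / 2) (-a) (1 / 2) hψ hc a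
    have hb : byParts ((a : ℂ) ^ 2 / 2) (-a) (1 / 2) ψ a = ψ a := by
      simp only [byParts, iteratedDeriv_zero]
      ring
    rw [hb] at h
    rw [← h]
    refine setIntegral_congr_fun measurableSet_Ioi fun t ht => ?_
    rw [ker_of_nonneg (sub_nonneg.2 (le_of_lt ht))]
    push_cast
    ring
  · intro t ht
    rw [ker_of_nonpos (sub_nonpos.2 (not_lt.1 ht)), zero_mul]

theorem quadratic_of_iterated_deriv_zero {f f1 f2 : ℝ → ℂ} (h0 : ∀ t, HasDerivAt f (f1 t) t)
    (h1 : ∀ t, HasDerivAt f1 (f2 t) t) (h2 : ∀ t, HasDerivAt f2 0 t) (t : ℝ) :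
    f t = f 0 + f1 0 * t + f2 0 / 2 * t ^ 2 := by
  have hid : ∀ t : ℝ, HasDerivAt (fun s : ℝ => (s : ℂ)) 1 t := fun t =>
    Complex.ofRealCLM.hasDerivAt
  have const : ∀ F : ℝ → ℂ, (∀ t, HasDerivAt F 0 t) → ∀ t, F t = F 0 := fun F hF t =>
    is_const_of_deriv_eq_zero (fun t => (hF t).differentiableAt) (fun t => (hF t).deriv) t 0
  have e2 : ∀ t, f2 t = f2 0 := const f2 h2
  have e1 : ∀ t : ℝ, f1 t = f1 0 + f2 0 * t := by
    intro t
    have := const (fun s => f1 s - f2 0 * s) (fun s => by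
      have := (h1 s).sub ((hid s).const_mul (f2 0))
      refine this.congr_deriv ?_
      rw [e2 s]; ring) t
    simp only [Complex.ofReal_zero, mul_zero, sub_zero] at this
    rw [← this]; ring
  have := const (fun s => f s - f1 0 * s - f2 0 / 2 * s ^ 2) (fun s => by
      have := ((h0 s).sub ((hid s).const_mul (f1 0))).sub (((hid s).pow 2).const_mul (f2 0 / 2))
      refine this.congr_deriv ?_
      rw [e1 s]; push_cast; ring) t
  simp only [Complex.ofReal_zero, mul_zero, sub_zero, ne_eq, OfNat.ofNat_ne_zero,
    not_false_eq_true, zero_pow] at this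
  rw [← this]; ring

/-- The quadratic polynomial interpolating `f` at `-1, 0, 1`. -/
noncomputable def lagrange (f : ℝ → ℂ) (t : ℝ) : ℂ :=
  f 0 + (f 1 - f (-1)) / 2 * t + ((f 1 + f (-1)) / 2 - f 0) * t ^ 2

open scoped Convolution in
/-- A continuous function with vanishing third distributional derivative is a quadratic
polynomial. -/
theorem quadratic_of_integral_mul_iteratedDeriv_eq_zero {w : ℝ → ℂ} (hw : Continuous w)
    (h : ∀ ψ : ℝ → ℂ, ContDiff ℝ ∞ ψ → HasCompactSupport ψ →
      ∫ t, w t * iteratedDeriv 3 ψ t = 0) (t : ℝ) :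
    w t = lagrange w t := by
  let L := ContinuousLinearMap.lsmul ℝ ℝ (E := ℂ)
  -- A mollification of `w` is smooth, and its third derivative at `t` is, up to sign, `w` tested
  -- against `s ↦ η (t - s)`. It is therefore quadratic and equals its own interpolant, an identity
  -- between four point values that survives the limit.
  have smooth : ∀ η : ℝ → ℝ, ContDiff ℝ ∞ η → HasCompactSupport η → ∀ t,
      (η ⋆[L, volume] w) t = lagrange (η ⋆[L, volume] w) t := by
    intro η hη hηc t
    have hd : ∀ k t, HasDerivAt (iteratedDeriv k η ⋆[L, volume] w)
        ((iteratedDeriv (k + 1) η ⋆[L, volume] w) t) t := fun k t => by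
      have := (hasCompactSupport_iteratedDeriv hηc k).hasDerivAt_convolution_left L
        ((contDiff_iteratedDeriv hη k).of_le (by exact_mod_cast le_top))
        (hw.locallyIntegrable (μ := volume)) t
      rwa [← iteratedDeriv_succ] at this
    have hz : ∀ t, (iteratedDeriv 3 η ⋆[L, volume] w) t = 0 := by
      intro t
      rw [convolution_eq_swap]
      have hψ : ContDiff ℝ ∞ (fun s : ℝ => ((η (t - s) : ℝ) : ℂ)) :=
        Complex.ofRealCLM.contDiff.comp (hη.comp (contDiff_const.sub contDiff_id))
      have hψc : HasCompactSupport (fun s : ℝ => ((η (t - s) : ℝ) : ℂ)) := by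
        have h1 : HasCompactSupport (fun s : ℝ => η (t - s)) :=
          hηc.comp_homeomorph (Homeomorph.subLeft t)
        exact h1.comp_left (g := fun r : ℝ => (r : ℂ)) Complex.ofReal_zero
      have hs : ∀ k s, iteratedDeriv k (fun s : ℝ => ((η (t - s) : ℝ) : ℂ)) s =
          (-1) ^ k * ((iteratedDeriv k η (t - s) : ℝ) : ℂ) := by
        intro k
        induction k with
        | zero => intro s; simp
        | succ k ih =>
          intro s
          rw [iteratedDeriv_succ, funext ih]
          have h1 : HasDerivAt (fun s : ℝ => t - s) (-1) s := by
            simpa using (hasDerivAt_id s).const_sub t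
          have h2 : HasDerivAt (fun s => iteratedDeriv k η (t - s))
              (iteratedDeriv (k + 1) η (t - s) * -1) s :=
            (hasDerivAt_iteratedDeriv hη k (t - s)).comp s h1
          rw [(h2.ofReal_comp.const_mul ((-1 : ℂ) ^ k)).deriv]
          push_cast
          ring
      have := h _ hψ hψc
      -- The sign is `(-1) ^ 3`, from differentiating the reflected function three times.
      rw [← neg_eq_zero, ← integral_neg] at this
      rw [← this]
      congr 1
      ext s
      rw [hs]
      simp [L]
      ring
    have q := quadratic_of_iterated_deriv_zero (hd 0) (hd 1)
      (fun t => by simpa [hz] using hd 2 t)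
    simp only [iteratedDeriv_zero] at q
    simp only [lagrange]
    rw [q t, q 1, q (-1)]
    push_cast
    ring
  let φ : ℕ → ContDiffBump (0 : ℝ) := fun n =>
    ⟨1 / (n + 2), 1 / (n + 1), by positivity, by
      apply one_div_lt_one_div_of_lt <;> [positivity; linarith]⟩
  have lim : ∀ t, Tendsto (fun n => (((φ n).normed volume) ⋆[L, volume] w) t) atTop (𝓝 (w t)) :=
    fun t => ContDiffBump.convolution_tendsto_right_of_continuous
      (tendsto_one_div_add_atTop_nhds_zero_nat (𝕜 := ℝ)) hw t
  have lim2 : Tendsto (fun n => lagrange (((φ n).normed volume) ⋆[L, volume] w) t) atTop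
      (𝓝 (lagrange w t)) := by
    unfold lagrange
    exact ((lim 0).add ((((lim 1).sub (lim (-1))).div_const 2).mul_const _)).add
      (((((lim 1).add (lim (-1))).div_const 2).sub (lim 0)).mul_const _)
  refine tendsto_nhds_unique (lim t) (lim2.congr fun n => ?_)
  exact (smooth _ (φ n).contDiff_normed (φ n).hasCompactSupport_normed t).symm

/-! ### Integral form of the string equation and right-hand boundary data -/

section MassMeasure

variable {n : ℕ} {x m : Fin n → ℝ}

theorem integral_massMeasure (hm : ∀ i, 0 < m i) (f : ℝ → ℂ) :
    ∫ t, f t ∂(massMeasure x m) = ∑ i, (m i : ℂ) * f (x i) := by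
  rw [massMeasure, integral_finsetSum_measure]
  · refine Finset.sum_congr rfl fun i _ => ?_
    rw [integral_smul_measure, integral_dirac, ENNReal.toReal_ofReal (hm i).le]
    simp
  · intro i _
    exact (integrable_dirac (by simp)).smul_measure ENNReal.ofReal_ne_top

theorem pairing_massMeasure (hm : ∀ i, 0 < m i) (hx0 : ∀ i, 0 < x i) (hx1 : ∀ i, x i ≤ 1)
    (f h : ℝ → ℂ) :
    pairing (massMeasure x m) f h = ∑ i, (m i : ℂ) * (f (x i) * h (x i)) := by
  rw [pairing, Measure.restrict_eq_self_of_ae_mem, integral_massMeasure hm]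
  rw [ae_iff, massMeasure, Measure.finsetSum_apply]
  refine Finset.sum_eq_zero fun i _ => ?_
  rw [Measure.smul_apply, Measure.dirac_apply, Set.indicator_of_notMem, smul_zero]
  simp [(hx0 i).le, hx1 i]

/-- A quadratic polynomial plus truncated quadratics starting at the nodes `x i`. -/
noncomputable def fwd (x m : Fin n → ℝ) (c A B C : ℂ) (v : Fin n → ℂ) (t : ℝ) : ℂ :=
  A + B * t + C * (t ^ 2 / 2) + c * ∑ i, (m i : ℂ) * (v i * ker (t - x i))

/-- A quadratic polynomial plus truncated quadratics ending at the nodes `x i`. -/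
noncomputable def bwd (x m : Fin n → ℝ) (c P Q R : ℂ) (v : Fin n → ℂ) (t : ℝ) : ℂ :=
  P + Q * (t - 1) + R * ((t - 1) ^ 2 / 2) - c * ∑ i, (m i : ℂ) * (v i * ker (x i - t))

@[fun_prop]
theorem continuous_fwd (c A B C : ℂ) (v : Fin n → ℂ) : Continuous (fwd x m c A B C v) := by
  unfold fwd
  fun_prop

theorem bwd_eq_fwd (c P Q R : ℂ) (v : Fin n → ℂ) :
    bwd x m c P Q R v = fwd x m c
      (P - Q + R / 2 - c * ∑ i, (m i : ℂ) * (v i * ((x i : ℂ) ^ 2 / 2)))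
      (Q - R + c * ∑ i, (m i : ℂ) * (v i * x i))
      (R - c * ∑ i, (m i : ℂ) * v i) v := by
  ext t
  have : ∑ i, (m i : ℂ) * (v i * ker (t - x i)) =
      (∑ i, (m i : ℂ) * v i) * (t ^ 2 / 2) - (∑ i, (m i : ℂ) * (v i * x i)) * t +
        ∑ i, (m i : ℂ) * (v i * ((x i : ℂ) ^ 2 / 2)) -
          ∑ i, (m i : ℂ) * (v i * ker (x i - t)) := by
    rw [Finset.sum_mul, Finset.sum_mul, ← Finset.sum_sub_distrib, ← Finset.sum_add_distrib,
      ← Finset.sum_sub_distrib]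
    refine Finset.sum_congr rfl fun i _ => ?_
    rw [ker_eq_sub, neg_sub]
    push_cast
    ring
  rw [fwd, bwd, this]
  ring

theorem fwd_eq_bwd (c A B C : ℂ) (v : Fin n → ℂ) :
    fwd x m c A B C v = bwd x m c
      (A + B + C / 2 + c * ∑ i, (m i : ℂ) * (v i * ((1 - x i : ℂ) ^ 2 / 2)))
      (B + C + c * ∑ i, (m i : ℂ) * (v i * (1 - x i)))
      (C + c * ∑ i, (m i : ℂ) * v i) v := by
  ext t
  have : ∑ i, (m i : ℂ) * (v i * ker (t - x i)) =
      (∑ i, (m i : ℂ) * v i) * ((t - 1) ^ 2 / 2) +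
        (∑ i, (m i : ℂ) * (v i * (1 - x i))) * (t - 1) +
        ∑ i, (m i : ℂ) * (v i * ((1 - x i : ℂ) ^ 2 / 2)) -
          ∑ i, (m i : ℂ) * (v i * ker (x i - t)) := by
    rw [Finset.sum_mul, Finset.sum_mul, ← Finset.sum_add_distrib, ← Finset.sum_add_distrib,
      ← Finset.sum_sub_distrib]
    refine Finset.sum_congr rfl fun i _ => ?_
    rw [ker_eq_sub, neg_sub]
    push_cast
    ring
  rw [fwd, bwd, this]
  ring

theorem integral_mul_iteratedDeriv_fwd (c A B C : ℂ) (v : Fin n → ℂ) {ψ : ℝ → ℂ}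
    (hψ : ContDiff ℝ ∞ ψ) (hc : HasCompactSupport ψ) :
    ∫ t, fwd x m c A B C v t * iteratedDeriv 3 ψ t =
      - (c * ∑ i, (m i : ℂ) * (v i * ψ (x i))) := by
  have hψ3 := (contDiff_iteratedDeriv hψ 3).continuous
  have hψ3c := hasCompactSupport_iteratedDeriv hc 3
  have int : ∀ f : ℝ → ℂ, Continuous f → Integrable (fun t => f t * iteratedDeriv 3 ψ t) :=
    fun f hf => (hf.mul hψ3).integrable_of_hasCompactSupport hψ3c.mul_left
  have e : ∀ t, fwd x m c A B C v t * iteratedDeriv 3 ψ t =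
      (A + B * t + C / 2 * t ^ 2) * iteratedDeriv 3 ψ t +
      ∑ i, (c * (m i * v i)) * (ker (t - x i) * iteratedDeriv 3 ψ t) := by
    intro t
    rw [fwd, add_mul, mul_assoc c, Finset.sum_mul, Finset.mul_sum]
    congr 1
    · ring
    · exact Finset.sum_congr rfl fun i _ => by ring
  simp_rw [e]
  rw [integral_add (int _ (by fun_prop))
    (integrable_finsetSum _ fun i _ => (int _ (by fun_prop)).const_mul _),
    integral_quadratic_mul_iteratedDeriv _ _ _ hψ hc, zero_add,
    integral_finsetSum _ fun i _ => (int _ (by fun_prop)).const_mul _, Finset.mul_sum,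
    ← Finset.sum_neg_distrib]
  refine Finset.sum_congr rfl fun i _ => ?_
  rw [integral_const_mul, integral_ker_mul_iteratedDeriv hψ hc]
  ring

/-- Subtracting the kernels weighted by the values of `u` at the nodes removes the whole third
derivative and leaves a quadratic polynomial. The equation becomes a fixed-point relation for the
node values. -/
theorem thirdDerivEq_iff_exists_fwd (hm : ∀ i, 0 < m i) (c : ℂ) (u : ℝ → ℂ) :
    ThirdDerivEq (massMeasure x m) c u ↔
      ∃ A B C : ℂ, u = fwd x m c A B C (fun i => u (x i)) := by
  simp only [ThirdDerivEq, integral_massMeasure hm]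
  constructor
  · rintro ⟨hu, h⟩
    set f := fwd x m c 0 0 0 (fun i => u (x i)) with hf
    have hfc : Continuous f := continuous_fwd _ _ _ _ _
    have key := quadratic_of_integral_mul_iteratedDeriv_eq_zero (w := fun t => u t - f t)
      (hu.sub hfc) (fun ψ hψ hc => by
        have hψ3 := (contDiff_iteratedDeriv hψ 3).continuous
        have hψ3c := hasCompactSupport_iteratedDeriv hc 3
        have int : ∀ f : ℝ → ℂ, Continuous f → Integrable (fun t => f t * iteratedDeriv 3 ψ t) :=
          fun f hf => (hf.mul hψ3).integrable_of_hasCompactSupport hψ3c.mul_left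
        simp_rw [sub_mul]
        rw [integral_sub (int _ hu) (int _ hfc), hf, integral_mul_iteratedDeriv_fwd _ _ _ _ _ hψ hc,
          ← h ψ hψ hc]
        ring)
    -- The coefficients of the interpolant of `u - f` at `-1, 0, 1`; the factor `2` is due to the
    -- normalization `t ^ 2 / 2` in `fwd`.
    refine ⟨u 0 - f 0, (u 1 - f 1 - (u (-1) - f (-1))) / 2,
      2 * ((u 1 - f 1 + (u (-1) - f (-1))) / 2 - (u 0 - f 0)), ?_⟩
    ext t
    have hft : f t = c * ∑ i, (m i : ℂ) * (u (x i) * ker (t - x i)) := by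
      simp [hf, fwd]
    have hkey := key t
    simp only [lagrange] at hkey
    rw [fwd]
    linear_combination hkey + hft
  · rintro ⟨A, B, C, h⟩
    have hc : Continuous u := by rw [h]; fun_prop
    refine ⟨hc, fun ψ hψ hψc => ?_⟩
    conv_lhs => rw [h]
    rw [integral_mul_iteratedDeriv_fwd _ _ _ _ _ hψ hψc, neg_neg]

theorem thirdDerivEq_iff_exists_bwd (hm : ∀ i, 0 < m i) (c : ℂ) (u : ℝ → ℂ) :
    ThirdDerivEq (massMeasure x m) c u ↔
      ∃ P Q R : ℂ, u = bwd x m c P Q R (fun i => u (x i)) := by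
  rw [thirdDerivEq_iff_exists_fwd hm]
  constructor
  · rintro ⟨A, B, C, h⟩
    rw [fwd_eq_bwd] at h
    exact ⟨_, _, _, h⟩
  · rintro ⟨A, B, C, h⟩
    rw [bwd_eq_fwd] at h
    exact ⟨_, _, _, h⟩

theorem rightDeriv_of_eventuallyEq {u f : ℝ → ℂ} {p : ℝ} (hf : ContDiff ℝ ∞ f)
    (h : u =ᶠ[𝓝[Set.Ici p] p] f) (k : ℕ) : rightDeriv k u p = iteratedDeriv k f p := by
  rw [← iteratedDerivWithin_eq_iteratedDeriv (uniqueDiffOn_Ici p)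
    ((hf.of_le (by exact_mod_cast le_top)).contDiffAt) (Set.mem_Ici.2 le_rfl)]
  rw [rightDeriv, iteratedDerivWithin, iteratedDerivWithin,
    h.iteratedFDerivWithin_eq (h.eq_of_nhdsWithin (Set.mem_Ici.2 le_rfl))]

theorem rightDeriv_of_eventuallyEq_quadratic {u : ℝ → ℂ} {p : ℝ} {α β γ : ℂ}
    (h : ∀ᶠ t in 𝓝[Set.Ici p] p, u t = α + β * (t - p) + γ * ((t - p) ^ 2 / 2)) :
    u p = α ∧ rightDeriv 1 u p = β ∧ rightDeriv 2 u p = γ := by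
  have hid : ∀ t : ℝ, HasDerivAt (fun s : ℝ => (s : ℂ) - p) 1 t := fun t =>
    (Complex.ofRealCLM.hasDerivAt (x := t)).sub_const _
  have hofr : ContDiff ℝ ∞ (fun s : ℝ => (s : ℂ)) := Complex.ofRealCLM.contDiff
  set f : ℝ → ℂ := fun t => α + β * (t - p) + γ * ((t - p) ^ 2 / 2) with hf
  have hfs : ContDiff ℝ ∞ f := by fun_prop
  have d1 : deriv f = fun t : ℝ => β + γ * ((t : ℂ) - p) := by
    ext t
    refine HasDerivAt.deriv ?_
    have := (((hid t).const_mul β).const_add α).add ((((hid t).pow 2).div_const 2).const_mul γ)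
    refine this.congr_deriv ?_
    push_cast; ring
  have d2 : deriv (deriv f) = fun _ : ℝ => γ := by
    rw [d1]
    ext t
    refine HasDerivAt.deriv ?_
    simpa using ((hid t).const_mul γ).const_add β
  refine ⟨?_, ?_, ?_⟩
  · have := h.self_of_nhdsWithin (Set.mem_Ici.2 le_rfl)
    simpa using this
  · rw [rightDeriv_of_eventuallyEq hfs h, iteratedDeriv_one, d1]
    simp
  · rw [rightDeriv_of_eventuallyEq hfs h, iteratedDeriv_succ, iteratedDeriv_one, d2]

theorem rightData_zero_fwd (hx0 : ∀ i, 0 < x i) (c A B C : ℂ) (v : Fin n → ℂ) :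
    fwd x m c A B C v 0 = A ∧ rightDeriv 1 (fwd x m c A B C v) 0 = B ∧
      rightDeriv 2 (fwd x m c A B C v) 0 = C := by
  apply rightDeriv_of_eventuallyEq_quadratic
  have : ∀ᶠ t in 𝓝 (0 : ℝ), ∀ i, t < x i :=
    eventually_all.2 fun i => eventually_lt_nhds (hx0 i)
  filter_upwards [mem_nhdsWithin_of_mem_nhds this] with t ht
  simp [fwd, fun i => ker_of_nonpos (sub_nonpos.2 (ht i).le)]

/-- For `t ≥ 1` every kernel `ker (x i - t)` vanishes, also when `x i = 1`. A mass at the end point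
is thus already included in the right-hand data. -/
theorem rightData_one_bwd (hx1 : ∀ i, x i ≤ 1) (c P Q R : ℂ) (v : Fin n → ℂ) :
    bwd x m c P Q R v 1 = P ∧ rightDeriv 1 (bwd x m c P Q R v) 1 = Q ∧
      rightDeriv 2 (bwd x m c P Q R v) 1 = R := by
  apply rightDeriv_of_eventuallyEq_quadratic
  filter_upwards [self_mem_nhdsWithin] with t ht
  simp [bwd, fun i => ker_of_nonpos (sub_nonpos.2 ((hx1 i).trans ht))]

theorem thirdDerivEq_iff_fwd (hm : ∀ i, 0 < m i) (hx0 : ∀ i, 0 < x i) (c : ℂ) (u : ℝ → ℂ) :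
    ThirdDerivEq (massMeasure x m) c u ↔
      u = fwd x m c (u 0) (rightDeriv 1 u 0) (rightDeriv 2 u 0) (fun i => u (x i)) := by
  rw [thirdDerivEq_iff_exists_fwd hm]
  refine ⟨?_, fun h => ⟨_, _, _, h⟩⟩
  rintro ⟨A, B, C, h⟩
  obtain ⟨hA, hB, hC⟩ := rightData_zero_fwd (m := m) hx0 c A B C (fun i => u (x i))
  rw [← h] at hA hB hC
  rw [hA, hB, hC]
  exact h

theorem thirdDerivEq_iff_bwd (hm : ∀ i, 0 < m i) (hx1 : ∀ i, x i ≤ 1) (c : ℂ) (u : ℝ → ℂ) :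
    ThirdDerivEq (massMeasure x m) c u ↔
      u = bwd x m c (u 1) (rightDeriv 1 u 1) (rightDeriv 2 u 1) (fun i => u (x i)) := by
  rw [thirdDerivEq_iff_exists_bwd hm]
  refine ⟨?_, fun h => ⟨_, _, _, h⟩⟩
  rintro ⟨P, Q, R, h⟩
  obtain ⟨hP, hQ, hR⟩ := rightData_one_bwd (m := m) hx1 c P Q R (fun i => u (x i))
  rw [← h] at hP hQ hR
  rw [hP, hQ, hR]
  exact h

theorem rightData_one_fwd (hx1 : ∀ i, x i ≤ 1) (c A B C : ℂ) (v : Fin n → ℂ) :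
    fwd x m c A B C v 1 =
        A + B + C / 2 + c * ∑ i, (m i : ℂ) * (v i * ((1 - x i : ℂ) ^ 2 / 2)) ∧
      rightDeriv 1 (fwd x m c A B C v) 1 = B + C + c * ∑ i, (m i : ℂ) * (v i * (1 - x i)) ∧
      rightDeriv 2 (fwd x m c A B C v) 1 = C + c * ∑ i, (m i : ℂ) * v i := by
  rw [fwd_eq_bwd]
  exact rightData_one_bwd hx1 _ _ _ _ _

end MassMeasure

/-! ### Inequalities propagated along the string -/

/-- Positivity of a state `(p, q, r)` of numbers `a + b i` with `i² = -κ`, at the parameter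
`s = s₁ + s₂ i`: the imaginary parts of `q p̄`, `r p̄`, `r q̄` are nonnegative and those of
`s p q̄`, `s p r̄`, `s q r̄` are positive. For `κ = 1` these are complex numbers, for `κ = 0` dual
numbers, that is, values together with derivatives. -/
structure PosState (κ s₁ s₂ p₁ p₂ q₁ q₂ r₁ r₂ : ℝ) : Prop where
  qp : 0 ≤ q₂ * p₁ - q₁ * p₂
  rp : 0 ≤ r₂ * p₁ - r₁ * p₂
  rq : 0 ≤ r₂ * q₁ - r₁ * q₂
  spq : 0 < (s₁ * p₂ + s₂ * p₁) * q₁ - (s₁ * p₁ - κ * s₂ * p₂) * q₂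
  spr : 0 < (s₁ * p₂ + s₂ * p₁) * r₁ - (s₁ * p₁ - κ * s₂ * p₂) * r₂
  sqr : 0 < (s₁ * q₂ + s₂ * q₁) * r₁ - (s₁ * q₁ - κ * s₂ * q₂) * r₂

section

variable {κ s₁ s₂ p₁ p₂ q₁ q₂ r₁ r₂ : ℝ}

/-- Positivity is preserved along a massless interval. -/
theorem PosState.translate (h : PosState κ s₁ s₂ p₁ p₂ q₁ q₂ r₁ r₂) (hκ : 0 ≤ κ) (hs : 0 < s₂)
    {l : ℝ} (hl : 0 ≤ l) :
    PosState κ s₁ s₂ (p₁ + l * q₁ + l ^ 2 / 2 * r₁) (p₂ + l * q₂ + l ^ 2 / 2 * r₂)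
      (q₁ + l * r₁) (q₂ + l * r₂) r₁ r₂ where
  qp := by
    have := mul_nonneg hl h.rp
    have := mul_nonneg (sq_nonneg l) h.rq
    linarith [h.qp]
  rp := by linarith [h.rp, mul_nonneg hl h.rq]
  rq := by linarith [h.rq]
  spq := by
    have h1 := mul_nonneg hl h.spr.le
    have h2 := mul_nonneg (sq_nonneg l) h.sqr.le
    -- All terms carrying `s₂`, after `Im (s r q̄)` is rewritten as `2 Im s · Re (q r̄) - Im (s q
    -- r̄)`; completing the square makes them visibly nonnegative.
    have h3 : 0 ≤ l * s₂ * ((q₁ + l / 2 * r₁) ^ 2 + l ^ 2 / 4 * r₁ ^ 2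
        + κ * ((q₂ + l / 2 * r₂) ^ 2 + l ^ 2 / 4 * r₂ ^ 2)) := by positivity
    linarith [h.spq]
  spr := by
    have h1 := mul_nonneg hl h.sqr.le
    have h2 : 0 ≤ l ^ 2 * s₂ * (r₁ ^ 2 + κ * r₂ ^ 2) := by positivity
    linarith [h.spr]
  sqr := by
    have h2 : 0 ≤ l * s₂ * (r₁ ^ 2 + κ * r₂ ^ 2) := by positivity
    linarith [h.sqr]

/-- Positivity is preserved across a point mass. -/
theorem PosState.jump (h : PosState κ s₁ s₂ p₁ p₂ q₁ q₂ r₁ r₂) (hκ : 0 ≤ κ) (hs : 0 < s₂)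
    {m : ℝ} (hm : 0 ≤ m) :
    PosState κ s₁ s₂ p₁ p₂ q₁ q₂ (r₁ + m * (s₁ * p₁ - κ * s₂ * p₂))
      (r₂ + m * (s₁ * p₂ + s₂ * p₁)) where
  qp := h.qp
  rp := by
    have : 0 ≤ m * s₂ * (p₁ ^ 2 + κ * p₂ ^ 2) := by positivity
    linarith [h.rp]
  rq := by linarith [h.rq, mul_nonneg hm h.spq.le]
  spq := h.spq
  spr := by linarith [h.spr]
  sqr := by
    have : 0 ≤ m * (s₁ ^ 2 + κ * s₂ ^ 2) * (q₂ * p₁ - q₁ * p₂) :=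
      mul_nonneg (by positivity) h.qp
    linarith [h.sqr]

end

/-- The sums describe the state at `ξ` produced by the first `k` masses alone. Induction on `k`:
take the state at the next node, jump across its mass, then translate to `ξ`. -/
theorem posState_of_recursion {n : ℕ} {x m : Fin n → ℝ} (hm : ∀ i, 0 < m i) (hx : StrictMono x)
    (hx0 : ∀ i, 0 < x i) {κ s₁ s₂ : ℝ} (hκ : 0 ≤ κ) (hs : 0 < s₂) {V₁ V₂ W₁ W₂ : Fin n → ℝ}
    (hW₁ : ∀ i, W₁ i = s₁ * V₁ i - κ * s₂ * V₂ i) (hW₂ : ∀ i, W₂ i = s₁ * V₂ i + s₂ * V₁ i)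
    (hV₁ : ∀ k, V₁ k = x k ^ 2 / 2 + ∑ i, m i * (W₁ i * (max (x k - x i) 0 ^ 2 / 2)))
    (hV₂ : ∀ k, V₂ k = ∑ i, m i * (W₂ i * (max (x k - x i) 0 ^ 2 / 2)))
    (k : ℕ) (hk : k ≤ n) (ξ : ℝ) (hξ : 0 < ξ) (hξx : ∀ i : Fin n, i.val < k → x i ≤ ξ) :
    PosState κ s₁ s₂
      (ξ ^ 2 / 2 + ∑ i with i.val < k, m i * (W₁ i * ((ξ - x i) ^ 2 / 2)))
      (∑ i with i.val < k, m i * (W₂ i * ((ξ - x i) ^ 2 / 2)))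
      (ξ + ∑ i with i.val < k, m i * (W₁ i * (ξ - x i)))
      (∑ i with i.val < k, m i * (W₂ i * (ξ - x i)))
      (1 + ∑ i with i.val < k, m i * W₁ i)
      (∑ i with i.val < k, m i * W₂ i) := by
  induction k generalizing ξ with
  | zero =>
    -- Without masses the state is `(ξ² / 2, ξ, 1)`. At `ξ = 0` the strict inequalities would fail,
    -- hence the requirement `0 < ξ`.
    simp only [not_lt_zero, Finset.filter_false, Finset.sum_empty, add_zero]
    constructor <;> simp <;> positivity
  | succ k ih =>
    set a : Fin n := ⟨k, hk⟩ with ha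
    have hins : (Finset.univ.filter fun i : Fin n => i.val < k + 1) =
        insert a (Finset.univ.filter fun i : Fin n => i.val < k) := by
      ext i
      simp [ha, Fin.ext_iff]
      omega
    have hnot : a ∉ Finset.univ.filter fun i : Fin n => i.val < k := by simp [ha]
    have trunc : ∀ W : Fin n → ℝ, ∑ i, m i * (W i * (max (x a - x i) 0 ^ 2 / 2)) =
        ∑ i with i.val < k, m i * (W i * ((x a - x i) ^ 2 / 2)) := by
      intro W
      rw [Finset.sum_filter]
      refine Finset.sum_congr rfl fun i _ => ?_
      split_ifs with hi
      · rw [max_eq_left (sub_nonneg.2 (hx.monotone (show i ≤ a from hi.le)))]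
      · rw [max_eq_right (sub_nonpos.2 (hx.monotone (show a ≤ i from not_lt.1 hi)))]
        simp
    have h := ((ih (by omega) (x a) (hx0 a) fun i hi => hx.monotone (show i ≤ a from hi.le)).jump
      hκ hs (hm a).le).translate hκ hs (sub_nonneg.2 (hξx a (by simp [ha])))
    -- The first component at the node is the node value `V`, so the jump `m s p` is `m * W`. Once
    -- this is recorded, `V` is expanded again.
    rw [← trunc W₁, ← trunc W₂, ← hV₁ a, ← hV₂ a, ← hW₁ a, ← hW₂ a] at h
    rw [hV₁ a, hV₂ a, trunc W₁, trunc W₂] at h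
    have quad : ∀ W : Fin n → ℝ, ∑ i with i.val < k, m i * (W i * ((ξ - x i) ^ 2 / 2)) =
        (∑ i with i.val < k, m i * (W i * ((x a - x i) ^ 2 / 2))) +
        (ξ - x a) * (∑ i with i.val < k, m i * (W i * (x a - x i))) +
        (ξ - x a) ^ 2 / 2 * ∑ i with i.val < k, m i * W i := by
      intro W
      rw [Finset.mul_sum, Finset.mul_sum, ← Finset.sum_add_distrib, ← Finset.sum_add_distrib]
      exact Finset.sum_congr rfl fun i _ => by ring
    have lin : ∀ W : Fin n → ℝ, ∑ i with i.val < k, m i * (W i * (ξ - x i)) =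
        (∑ i with i.val < k, m i * (W i * (x a - x i))) +
        (ξ - x a) * ∑ i with i.val < k, m i * W i := by
      intro W
      rw [Finset.mul_sum, ← Finset.sum_add_distrib]
      exact Finset.sum_congr rfl fun i _ => by ring
    simp only [hins, Finset.sum_insert hnot, quad, lin]
    convert h using 1 <;> ring

/-- At the end point `1` none of the three components of the state vanishes. -/
theorem state_one_ne_zero {n : ℕ} {x m : Fin n → ℝ} (hm : ∀ i, 0 < m i) (hx : StrictMono x)
    (hx0 : ∀ i, 0 < x i) (hx1 : ∀ i, x i ≤ 1) {κ s₁ s₂ : ℝ} (hκ : 0 ≤ κ) (hs : 0 < s₂)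
    {V₁ V₂ W₁ W₂ : Fin n → ℝ}
    (hW₁ : ∀ i, W₁ i = s₁ * V₁ i - κ * s₂ * V₂ i) (hW₂ : ∀ i, W₂ i = s₁ * V₂ i + s₂ * V₁ i)
    (hV₁ : ∀ k, V₁ k = x k ^ 2 / 2 + ∑ i, m i * (W₁ i * (max (x k - x i) 0 ^ 2 / 2)))
    (hV₂ : ∀ k, V₂ k = ∑ i, m i * (W₂ i * (max (x k - x i) 0 ^ 2 / 2))) :
    ¬ (1 / 2 + ∑ i, m i * (W₁ i * ((1 - x i) ^ 2 / 2)) = 0 ∧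
        ∑ i, m i * (W₂ i * ((1 - x i) ^ 2 / 2)) = 0) ∧
      ¬ (1 + ∑ i, m i * (W₁ i * (1 - x i)) = 0 ∧ ∑ i, m i * (W₂ i * (1 - x i)) = 0) ∧
      ¬ (1 + ∑ i, m i * W₁ i = 0 ∧ ∑ i, m i * W₂ i = 0) := by
  have h := posState_of_recursion hm hx hx0 hκ hs hW₁ hW₂ hV₁ hV₂ n le_rfl 1 one_pos
    fun i _ => hx1 i
  have hf : (Finset.univ.filter fun i : Fin n => i.val < n) = Finset.univ := by
    ext i
    simp
  rw [hf, one_pow] at h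
  refine ⟨?_, ?_, ?_⟩
  · rintro ⟨h1, h2⟩
    have := h.spq
    rw [h1, h2] at this
    simp at this
  · rintro ⟨h1, h2⟩
    have := h.spq
    rw [h1, h2] at this
    simp at this
  · rintro ⟨h1, h2⟩
    have := h.spr
    rw [h1, h2] at this
    simp at this

/-! ### Strictly triangular systems -/

section Triangular

variable {α : Type*} [Fintype α] (r : α → α → Prop) [IsWellFounded α r]

/-- A strictly triangular linear system of second kind is uniquely solvable. -/
theorem existsUnique_triangular {T : α → α → ℂ} (hT : ∀ k i, ¬ r i k → T k i = 0) (f : α → ℂ) :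
    ∃! v : α → ℂ, ∀ k, v k = f k + ∑ i, T k i * v i := by
  let L : (α → ℂ) →ₗ[ℂ] (α → ℂ) := LinearMap.id - Matrix.mulVecLin (Matrix.of T)
  have hL : ∀ v k, L v k = v k - ∑ i, T k i * v i := fun v k => by
    simp [L, Matrix.mulVec, dotProduct]
  have inj : Function.Injective L := by
    rw [injective_iff_map_eq_zero]
    intro v hv
    ext k
    induction k using IsWellFounded.induction r with
    | ind k ih =>
      have h := congrFun hv k
      rw [hL, Finset.sum_eq_zero, sub_zero] at h
      · exact h
      · intro i _
        by_cases hi : r i k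
        · rw [ih i hi, Pi.zero_apply, mul_zero]
        · rw [hT k i hi, zero_mul]
  have e : ∀ v, (∀ k, v k = f k + ∑ i, T k i * v i) ↔ L v = f := by
    intro v
    rw [funext_iff]
    exact forall_congr' fun k => by rw [hL, sub_eq_iff_eq_add]
  simp only [e]
  obtain ⟨v, hv⟩ := LinearMap.injective_iff_surjective.1 inj f
  exact ⟨v, hv, fun w hw => inj (hw.trans hv.symm)⟩

/-- Each unknown is an affine expression in strictly earlier ones with coefficients polynomial in
`z`, so differentiability follows by well-founded induction. -/
theorem differentiable_of_triangular {S : α → α → ℂ} (hS : ∀ k i, ¬ r i k → S k i = 0)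
    {f : α → ℂ} {v : ℂ → α → ℂ} (hv : ∀ z k, v z k = f k + z * ∑ i, S k i * v z i) (k : α) :
    Differentiable ℂ fun z => v z k := by
  induction k using IsWellFounded.induction r with
  | ind k ih =>
    simp only [fun z => hv z k]
    refine (differentiable_const _).add (differentiable_id.mul
      (Differentiable.fun_sum fun i _ => ?_))
    by_cases hi : r i k
    · exact (differentiable_const _).mul (ih i hi)
    · simp only [hS k i hi, zero_mul]
      exact differentiable_const _

end Triangular

/-! ### Initial value problems from either end, and Lagrange's identity -/

section Solutions

variable {n : ℕ} {x m : Fin n → ℝ}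

theorem existsUnique_fwd_nodes (hx : StrictMono x) (c A B C : ℂ) :
    ∃! v : Fin n → ℂ, ∀ k, v k = fwd x m c A B C v (x k) := by
  have h := existsUnique_triangular (· < ·) (T := fun k i : Fin n => c * (m i * ker (x k - x i)))
    (fun k i hki => by rw [ker_of_nonpos (sub_nonpos.2 (hx.monotone (not_lt.1 hki)))]; ring)
    (fun k => A + B * x k + C * (x k ^ 2 / 2))
  convert h using 5 with v k
  rw [fwd, Finset.mul_sum]
  congr 1
  exact Finset.sum_congr rfl fun i _ => by ring

theorem existsUnique_bwd_nodes (hx : StrictMono x) (c P Q R : ℂ) :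
    ∃! v : Fin n → ℂ, ∀ k, v k = bwd x m c P Q R v (x k) := by
  have h := existsUnique_triangular (· > ·) (T := fun k i : Fin n => -c * (m i * ker (x i - x k)))
    (fun k i hki => by rw [ker_of_nonpos (sub_nonpos.2 (hx.monotone (not_lt.1 hki)))]; ring)
    (fun k => P + Q * (x k - 1) + R * ((x k - 1) ^ 2 / 2))
  convert h using 5 with v k
  rw [bwd, sub_eq_add_neg, ← neg_mul, Finset.mul_sum]
  congr 1
  exact Finset.sum_congr rfl fun i _ => by ring

/-- Homogeneity of `fwd` shows that the node values of `f` and of `D * u` solve the same triangular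
system; uniqueness there carries over to the whole line. -/
theorem fwd_eq_smul (hx : StrictMono x) {c A B C D : ℂ} {u f : ℝ → ℂ}
    (hu : u = fwd x m c A B C (fun i => u (x i)))
    (hf : f = fwd x m c (D * A) (D * B) (D * C) (fun i => f (x i))) : f = fun t => D * u t := by
  have lin : ∀ (v : Fin n → ℂ) t, fwd x m c (D * A) (D * B) (D * C) (fun i => D * v i) t =
      D * fwd x m c A B C v t := by
    intro v t
    have : ∑ i, (m i : ℂ) * (D * v i * ker (t - x i)) =
        D * ∑ i, (m i : ℂ) * (v i * ker (t - x i)) := by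
      rw [Finset.mul_sum]
      exact Finset.sum_congr rfl fun i _ => by ring
    rw [fwd, fwd, this]
    ring
  have hv : (fun i => f (x i)) = fun i => D * u (x i) :=
    (existsUnique_fwd_nodes hx c _ _ _).unique (fun k => congrFun hf (x k)) fun k => by
      rw [lin, ← congrFun hu (x k)]
  ext t
  rw [hf, hv, lin, ← congrFun hu t]

theorem bwd_eq_smul (hx : StrictMono x) {c P Q R D : ℂ} {u f : ℝ → ℂ}
    (hu : u = bwd x m c P Q R (fun i => u (x i)))
    (hf : f = bwd x m c (D * P) (D * Q) (D * R) (fun i => f (x i))) : f = fun t => D * u t := by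
  have lin : ∀ (v : Fin n → ℂ) t, bwd x m c (D * P) (D * Q) (D * R) (fun i => D * v i) t =
      D * bwd x m c P Q R v t := by
    intro v t
    have : ∑ i, (m i : ℂ) * (D * v i * ker (x i - t)) =
        D * ∑ i, (m i : ℂ) * (v i * ker (x i - t)) := by
      rw [Finset.mul_sum]
      exact Finset.sum_congr rfl fun i _ => by ring
    rw [bwd, bwd, this]
    ring
  have hv : (fun i => f (x i)) = fun i => D * u (x i) :=
    (existsUnique_bwd_nodes hx c _ _ _).unique (fun k => congrFun hf (x k)) fun k => by
      rw [lin, ← congrFun hu (x k)]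
  ext t
  rw [hf, hv, lin, ← congrFun hu t]

theorem existsUnique_initialValue (hm : ∀ i, 0 < m i) (hx : StrictMono x) (hx0 : ∀ i, 0 < x i)
    (c A B C : ℂ) : ∃! u : ℝ → ℂ, ThirdDerivEq (massMeasure x m) c u ∧
      u 0 = A ∧ rightDeriv 1 u 0 = B ∧ rightDeriv 2 u 0 = C := by
  obtain ⟨v, hv, huniq⟩ := existsUnique_fwd_nodes (m := m) hx c A B C
  refine ⟨fwd x m c A B C v, ⟨(thirdDerivEq_iff_exists_fwd hm c _).2 ⟨A, B, C, ?_⟩,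
    rightData_zero_fwd hx0 c A B C v⟩, ?_⟩
  · congr 1
    exact funext hv
  · rintro u ⟨hu, rfl, rfl, rfl⟩
    have h := (thirdDerivEq_iff_fwd hm hx0 c u).1 hu
    rw [← huniq _ fun k => congrFun h (x k)]
    exact h

theorem existsUnique_terminalValue (hm : ∀ i, 0 < m i) (hx : StrictMono x) (hx1 : ∀ i, x i ≤ 1)
    (c P Q R : ℂ) : ∃! u : ℝ → ℂ, ThirdDerivEq (massMeasure x m) c u ∧
      u 1 = P ∧ rightDeriv 1 u 1 = Q ∧ rightDeriv 2 u 1 = R := by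
  obtain ⟨v, hv, huniq⟩ := existsUnique_bwd_nodes (m := m) hx c P Q R
  refine ⟨bwd x m c P Q R v, ⟨(thirdDerivEq_iff_exists_bwd hm c _).2 ⟨P, Q, R, ?_⟩,
    rightData_one_bwd hx1 c P Q R v⟩, ?_⟩
  · congr 1
    exact funext hv
  · rintro u ⟨hu, rfl, rfl, rfl⟩
    have h := (thirdDerivEq_iff_bwd hm hx1 c u).1 hu
    rw [← huniq _ fun k => congrFun h (x k)]
    exact h

/-- Lagrange's identity for a solution `v` of the cubic string with initial data `(0, 0, 1)` at
`0` and a solution `w` of the adjoint string with data `(P, Q, R)` at `1`. -/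
theorem lagrange_identity {c d P Q R : ℂ} {v w : Fin n → ℂ}
    (hv : ∀ k, v k = fwd x m c 0 0 1 v (x k)) (hw : ∀ k, w k = bwd x m d P Q R w (x k)) :
    (c + d) * ∑ i, (m i : ℂ) * (v i * w i) =
      (1 + c * ∑ i, (m i : ℂ) * v i) * P - (1 + c * ∑ i, (m i : ℂ) * (v i * (1 - x i))) * Q +
      (1 / 2 + c * ∑ i, (m i : ℂ) * (v i * ((1 - x i : ℂ) ^ 2 / 2))) * R -
      (P - Q + R / 2 - d * ∑ i, (m i : ℂ) * (w i * ((x i : ℂ) ^ 2 / 2))) := by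
  -- A discrete substitute for integration by parts: expanding `w` from the right end (`h1`) and `v`
  -- from the left end (`h2`) produces the same double sum, with coefficients `-d` and `c`. It
  -- cancels in `c * h1 + d * h2`.
  set D : ℂ := ∑ i, ∑ j, (m i : ℂ) * m j * (v i * w j) * ker (x j - x i) with hD
  have h1 : ∑ i, (m i : ℂ) * (v i * w i) = (∑ i, (m i : ℂ) * v i) * P -
      (∑ i, (m i : ℂ) * (v i * (1 - x i))) * Q +
      (∑ i, (m i : ℂ) * (v i * ((1 - x i : ℂ) ^ 2 / 2))) * R - d * D := by
    rw [hD, Finset.sum_mul, Finset.sum_mul, Finset.sum_mul, Finset.mul_sum,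
      ← Finset.sum_sub_distrib, ← Finset.sum_add_distrib, ← Finset.sum_sub_distrib]
    refine Finset.sum_congr rfl fun i _ => ?_
    have : ∑ j, (m i : ℂ) * m j * (v i * w j) * ker (x j - x i) =
        m i * v i * ∑ j, (m j : ℂ) * (w j * ker (x j - x i)) := by
      rw [Finset.mul_sum]
      exact Finset.sum_congr rfl fun j _ => by ring
    rw [this, hw i, bwd]
    ring
  have h2 : ∑ i, (m i : ℂ) * (v i * w i) = ∑ i, (m i : ℂ) * (w i * ((x i : ℂ) ^ 2 / 2)) +
      c * D := by
    rw [hD, Finset.sum_comm, Finset.mul_sum, ← Finset.sum_add_distrib]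
    refine Finset.sum_congr rfl fun i _ => ?_
    have : ∑ j, (m j : ℂ) * m i * (v j * w i) * ker (x i - x j) =
        m i * w i * ∑ j, (m j : ℂ) * (v j * ker (x i - x j)) := by
      rw [Finset.mul_sum]
      exact Finset.sum_congr rfl fun j _ => by ring
    rw [this, hv i, fwd]
    ring
  linear_combination c * h1 + d * h2

end Solutions

/-! ### Boundary functionals and simplicity of their zeros -/

/-- The value at `1` of the boundary functional of Type `a` on the massless string. -/
noncomputable def bdryConst (a : Fin 3) : ℝ :=
  match a with
  | 0 => 1 / 2
  | 1 => 1
  | 2 => 1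

/-- The boundary functional of Type `a` at `1` of the truncated quadratic starting at `t`. -/
noncomputable def bdryWeight (a : Fin 3) (t : ℝ) : ℝ :=
  match a with
  | 0 => (1 - t) ^ 2 / 2
  | 1 => 1 - t
  | 2 => 1

/-- The boundary functional of Type `a` at `1`. -/
noncomputable def bdryValue (a : Fin 3) (u : ℝ → ℂ) : ℂ :=
  match a with
  | 0 => u 1
  | 1 => rightDeriv 1 u 1
  | 2 => rightDeriv 2 u 1

theorem boundaryCondition_iff (a : Fin 3) (u : ℝ → ℂ) :
    BoundaryCondition a u ↔ u 0 = 0 ∧ rightDeriv 1 u 0 = 0 ∧ bdryValue a u = 0 := by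
  fin_cases a <;> rfl

theorem adjointInitialCondition_iff (a : Fin 3) (u : ℝ → ℂ) :
    AdjointInitialCondition a u ↔ u 1 = (if a = 2 then 1 else 0) ∧
      rightDeriv 1 u 1 = (if a = 1 then 1 else 0) ∧
      rightDeriv 2 u 1 = (if a = 0 then 1 else 0) := by
  fin_cases a <;> simp [AdjointInitialCondition]

/-- The conditions at `1` leave a single datum free. This is `D`, the factor by which an adjoint
eigenfunction will differ from the normalized solution. -/
theorem adjointBoundaryCondition_iff (a : Fin 3) (u : ℝ → ℂ) :
    AdjointBoundaryCondition a u ↔ u 0 = 0 ∧ ∃ D : ℂ, u 1 = D * (if a = 2 then 1 else 0) ∧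
      rightDeriv 1 u 1 = D * (if a = 1 then 1 else 0) ∧
      rightDeriv 2 u 1 = D * (if a = 0 then 1 else 0) := by
  fin_cases a <;> simp [AdjointBoundaryCondition]

section

variable {n : ℕ} {x m : Fin n → ℝ}

theorem bdryValue_fwd (hx1 : ∀ i, x i ≤ 1) (a : Fin 3) (c C : ℂ) (v : Fin n → ℂ) :
    bdryValue a (fwd x m c 0 0 C v) =
      C * bdryConst a + c * ∑ i, (m i : ℂ) * (v i * bdryWeight a (x i)) := by
  obtain ⟨h0, h1, h2⟩ := rightData_one_fwd (m := m) hx1 c 0 0 C v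
  fin_cases a
  · refine h0.trans ?_
    simp [bdryConst, bdryWeight]
    ring
  · refine h1.trans ?_
    simp [bdryConst, bdryWeight]
  · refine h2.trans ?_
    simp [bdryConst, bdryWeight]

theorem bdry_ne_zero (hm : ∀ i, 0 < m i) (hx : StrictMono x)
    (hx0 : ∀ i, 0 < x i) (hx1 : ∀ i, x i ≤ 1) (a : Fin 3) {κ s₁ s₂ : ℝ} (hκ : 0 ≤ κ) (hs : 0 < s₂)
    {V₁ V₂ W₁ W₂ : Fin n → ℝ}
    (hW₁ : ∀ i, W₁ i = s₁ * V₁ i - κ * s₂ * V₂ i) (hW₂ : ∀ i, W₂ i = s₁ * V₂ i + s₂ * V₁ i)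
    (hV₁ : ∀ k, V₁ k = x k ^ 2 / 2 + ∑ i, m i * (W₁ i * (max (x k - x i) 0 ^ 2 / 2)))
    (hV₂ : ∀ k, V₂ k = ∑ i, m i * (W₂ i * (max (x k - x i) 0 ^ 2 / 2)))
    (h₁ : bdryConst a + ∑ i, m i * (W₁ i * bdryWeight a (x i)) = 0)
    (h₂ : ∑ i, m i * (W₂ i * bdryWeight a (x i)) = 0) : False := by
  obtain ⟨h0, h1, h2⟩ := state_one_ne_zero hm hx hx0 hx1 hκ hs hW₁ hW₂ hV₁ hV₂
  fin_cases a
  · exact h0 ⟨h₁, h₂⟩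
  · exact h1 ⟨h₁, h₂⟩
  · refine h2 ⟨?_, ?_⟩
    · simpa [bdryConst, bdryWeight] using h₁
    · simpa [bdryWeight] using h₂

theorem re_sum_mul_ofReal (g : Fin n → ℝ) (W : Fin n → ℂ) :
    (∑ i, (m i : ℂ) * (W i * (g i : ℂ))).re = ∑ i, m i * ((W i).re * g i) := by
  rw [Complex.re_sum]
  exact Finset.sum_congr rfl fun i _ => by simp

theorem im_sum_mul_ofReal (g : Fin n → ℝ) (W : Fin n → ℂ) :
    (∑ i, (m i : ℂ) * (W i * (g i : ℂ))).im = ∑ i, m i * ((W i).im * g i) := by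
  rw [Complex.im_sum]
  exact Finset.sum_congr rfl fun i _ => by simp

/-- The characteristic function of Type `a`, in terms of the values at the nodes. -/
noncomputable def charFn (x m : Fin n → ℝ) (v : ℂ → Fin n → ℂ) (a : Fin 3) (z : ℂ) : ℂ :=
  bdryConst a + ∑ i, (m i : ℂ) * (-z * v z i * bdryWeight a (x i))

/-- The zeros of the characteristic functions are simple. -/
theorem deriv_charFn_ne_zero (hm : ∀ i, 0 < m i) (hx : StrictMono x)
    (hx0 : ∀ i, 0 < x i) (hx1 : ∀ i, x i ≤ 1) {v : ℂ → Fin n → ℂ}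
    (hv : ∀ z k, v z k = (x k : ℂ) ^ 2 / 2 +
      ∑ i, (m i : ℂ) * (-z * v z i * ker (x k - x i)))
    (hd : ∀ k, Differentiable ℂ fun z => v z k) (a : Fin 3) {z : ℂ} (hz : charFn x m v a z = 0) :
    deriv (charFn x m v a) z ≠ 0 := by
  have hvre : ∀ k, (v z k).re = x k ^ 2 / 2 +
      ∑ i, m i * ((-z * v z i).re * (max (x k - x i) 0 ^ 2 / 2)) := by
    intro k
    rw [hv z k, Complex.add_re, ← re_sum_mul_ofReal]
    congr 1
    norm_cast
  have hvim : ∀ k, (v z k).im =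
      ∑ i, m i * ((-z * v z i).im * (max (x k - x i) 0 ^ 2 / 2)) := by
    intro k
    rw [hv z k, Complex.add_im, ← im_sum_mul_ofReal]
    have : ((x k : ℂ) ^ 2 / 2).im = 0 := by norm_cast
    rw [this, zero_add]
    rfl
  have hzre : bdryConst a + ∑ i, m i * ((-z * v z i).re * bdryWeight a (x i)) = 0 := by
    rw [← re_sum_mul_ofReal]
    simpa [charFn] using congrArg Complex.re hz
  have hzim : ∑ i, m i * ((-z * v z i).im * bdryWeight a (x i)) = 0 := by
    rw [← im_sum_mul_ofReal]
    simpa [charFn] using congrArg Complex.im hz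
  rcases lt_trichotomy z.im 0 with him | him | him
  -- Here `s = -z` lies in the upper half plane, so a zero is impossible.
  · exact (bdry_ne_zero hm hx hx0 hx1 a (κ := 1) (s₁ := -z.re) (s₂ := -z.im) zero_le_one
      (neg_pos.2 him) (V₁ := fun i => (v z i).re) (V₂ := fun i => (v z i).im)
      (fun i => by simp; ring) (fun i => by simp; ring) hvre hvim hzre hzim).elim
  · intro hder
    have hdv : ∀ i, HasDerivAt (fun w => -w * v w i) (-z * deriv (fun w => v w i) z - v z i) z := by
      intro i
      refine ((hasDerivAt_id z).neg.mul (hd i z).hasDerivAt).congr_deriv ?_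
      simp
      ring
    have hdsum : ∀ (e : ℂ) (g : Fin n → ℂ), HasDerivAt
        (fun w => e + ∑ i, (m i : ℂ) * (-w * v w i * g i))
        (∑ i, (m i : ℂ) * ((-z * deriv (fun w => v w i) z - v z i) * g i)) z := by
      intro e g
      exact (HasDerivAt.fun_sum fun i _ => ((hdv i).mul_const _).const_mul _).const_add _
    have hdk : ∀ k, -deriv (fun w => v w k) z = ∑ i, (m i : ℂ) *
        (-(-z * deriv (fun w => v w i) z - v z i) * ((max (x k - x i) 0 ^ 2 / 2 : ℝ) : ℂ)) := by
      intro k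
      have h := (hdsum ((x k : ℂ) ^ 2 / 2) (fun i => ker (x k - x i))).deriv
      rw [funext fun w => hv w k, h, ← Finset.sum_neg_distrib]
      refine Finset.sum_congr rfl fun i _ => ?_
      rw [ker]
      ring
    have hza : ∑ i, (m i : ℂ) * (-(-z * deriv (fun w => v w i) z - v z i) *
        (bdryWeight a (x i) : ℂ)) = 0 := by
      have h := (hdsum (bdryConst a) (fun i => bdryWeight a (x i))).deriv
      rw [← neg_eq_zero, ← Finset.sum_neg_distrib, ← hder]
      unfold charFn
      rw [h]
      exact Finset.sum_congr rfl fun i _ => by ring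
    -- Dual numbers with `s = -z + ε`: differentiation in `s` is minus differentiation in `z`, which
    -- explains the signs of `V₂` and `W₂`. For real `z` the recursion has real coefficients, so
    -- real parts satisfy it by themselves.
    refine bdry_ne_zero hm hx hx0 hx1 a (κ := 0) (s₁ := -z.re) (s₂ := 1) le_rfl one_pos
      (V₁ := fun i => (v z i).re) (V₂ := fun i => (-deriv (fun w => v w i) z).re)
      (W₁ := fun i => (-z * v z i).re)
      (W₂ := fun i => (-(-z * deriv (fun w => v w i) z - v z i)).re)
      (fun i => by simp [him]) (fun i => by simp [him]; ring) hvre (fun k => ?_) hzre ?_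
    · rw [hdk k, re_sum_mul_ofReal]
    · simpa [re_sum_mul_ofReal] using congrArg Complex.re hza
  -- The complex conjugate of the recursion, with `s` the conjugate of `-z`.
  · refine (bdry_ne_zero hm hx hx0 hx1 a (κ := 1) (s₁ := -z.re) (s₂ := z.im) zero_le_one
      him (V₁ := fun i => (v z i).re) (V₂ := fun i => -(v z i).im)
      (W₁ := fun i => (-z * v z i).re) (W₂ := fun i => -(-z * v z i).im)
      (fun i => by simp; ring) (fun i => by simp) hvre (fun k => ?_) hzre ?_).elim
    · simp only [hvim k, neg_mul, mul_neg, Finset.sum_neg_distrib]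
    · simpa only [neg_mul, mul_neg, Finset.sum_neg_distrib, neg_eq_zero] using hzim

end

/-! ### Spectra, pairings and derivatives -/

section

variable {n : ℕ} {x m : Fin n → ℝ}

theorem IsIVPSolution.eq_fwd (hm : ∀ i, 0 < m i) (hx0 : ∀ i, 0 < x i) {z : ℂ} {u : ℝ → ℂ}
    (h : IsIVPSolution (massMeasure x m) z u) :
    u = fwd x m (-z) 0 0 1 (fun i => u (x i)) := by
  obtain ⟨hu, h0, h1, h2⟩ := h
  simpa only [h0, h1, h2] using (thirdDerivEq_iff_fwd hm hx0 (-z) u).1 hu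

theorem IsAdjointIVPSolution.eq_bwd (hm : ∀ i, 0 < m i) (hx1 : ∀ i, x i ≤ 1) {a : Fin 3} {z : ℂ}
    {u : ℝ → ℂ} (h : IsAdjointIVPSolution (massMeasure x m) a z u) :
    u = bwd x m z (if a = 2 then 1 else 0) (if a = 1 then 1 else 0) (if a = 0 then 1 else 0)
      (fun i => u (x i)) := by
  obtain ⟨hu, hi⟩ := h
  obtain ⟨h0, h1, h2⟩ := (adjointInitialCondition_iff a u).1 hi
  simpa only [h0, h1, h2] using (thirdDerivEq_iff_bwd hm hx1 z u).1 hu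

theorem bdryValue_eq_charFn (hm : ∀ i, 0 < m i) (hx0 : ∀ i, 0 < x i) (hx1 : ∀ i, x i ≤ 1)
    {φ : ℂ → ℝ → ℂ} (hφ : ∀ z, IsIVPSolution (massMeasure x m) z (φ z)) (a : Fin 3) (z : ℂ) :
    bdryValue a (φ z) = charFn x m (fun z i => φ z (x i)) a z := by
  conv_lhs => rw [(hφ z).eq_fwd hm hx0]
  rw [bdryValue_fwd hx1, charFn, Finset.mul_sum, one_mul]
  congr 1
  exact Finset.sum_congr rfl fun i _ => by ring

/-- If all node values vanished, the solution would be `t² / 2`, which is not zero at `1`. -/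
theorem IsIVPSolution.exists_ne_zero (hm : ∀ i, 0 < m i) (hx0 : ∀ i, 0 < x i)
    (hx1 : ∀ i, x i ≤ 1) {z : ℂ} {u : ℝ → ℂ} (h : IsIVPSolution (massMeasure x m) z u) :
    ∃ ξ ∈ Set.Icc (0 : ℝ) 1, u ξ ≠ 0 := by
  by_contra! H
  have h1 := congrFun (h.eq_fwd hm hx0) 1
  have hv : (fun i => u (x i)) = fun _ => 0 := funext fun i => H _ ⟨(hx0 i).le, hx1 i⟩
  rw [hv, H 1 (by simp)] at h1
  simp [fwd] at h1

theorem IsAdjointIVPSolution.exists_ne_zero (hm : ∀ i, 0 < m i) (hx0 : ∀ i, 0 < x i)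
    (hx1 : ∀ i, x i ≤ 1) {a : Fin 3} {z : ℂ} {u : ℝ → ℂ}
    (h : IsAdjointIVPSolution (massMeasure x m) a z u) :
    ∃ ξ ∈ Set.Icc (0 : ℝ) 1, u ξ ≠ 0 := by
  by_contra! H
  have hv : (fun i => u (x i)) = fun _ => 0 := funext fun i => H _ ⟨(hx0 i).le, hx1 i⟩
  have zero : ∀ P Q R : ℂ, u = bwd x m z P Q R (fun i => u (x i)) → P = 0 ∧ Q = 0 ∧ R = 0 := by
    intro P Q R he
    rw [hv] at he
    have h0 := congrFun he 0
    have h1 := congrFun he 1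
    -- With zero node values only a quadratic polynomial is left, and the three zeros `0`, `1/2`,
    -- `1` annihilate it.
    have h2 := congrFun he (1 / 2)
    rw [H _ (by constructor <;> norm_num)] at h0 h1 h2
    simp only [bwd, zero_mul, mul_zero, Finset.sum_const_zero, sub_zero] at h0 h1 h2
    push_cast at h0 h1 h2
    refine ⟨?_, ?_, ?_⟩
    · linear_combination -h1
    · linear_combination -h0 - 3 * h1 + 4 * h2
    · linear_combination -4 * h0 - 4 * h1 + 8 * h2
  obtain ⟨hP, hQ, hR⟩ := zero _ _ _ (h.eq_bwd hm hx1)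
  fin_cases a
  · exact one_ne_zero hR
  · exact one_ne_zero hQ
  · exact one_ne_zero hP

/-- An eigenfunction is a multiple of the solution of the initial value problem. -/
theorem eq_smul_of_isSolution (hm : ∀ i, 0 < m i) (hx : StrictMono x) (hx0 : ∀ i, 0 < x i)
    {z : ℂ} {u f : ℝ → ℂ} (hu : IsIVPSolution (massMeasure x m) z u)
    (hf : IsSolution (massMeasure x m) z f) (h0 : f 0 = 0) (h1 : rightDeriv 1 f 0 = 0) :
    f = fun t => rightDeriv 2 f 0 * u t := by
  refine fwd_eq_smul hx (hu.eq_fwd hm hx0) ?_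
  simpa only [h0, h1, mul_zero, mul_one] using (thirdDerivEq_iff_fwd hm hx0 (-z) f).1 hf

theorem isEigenfunction_iff (hm : ∀ i, 0 < m i) (hx0 : ∀ i, 0 < x i) (hx1 : ∀ i, x i ≤ 1)
    (a : Fin 3) {z : ℂ} {u : ℝ → ℂ} (hu : IsIVPSolution (massMeasure x m) z u) :
    IsEigenfunction (massMeasure x m) a z u ↔ bdryValue a u = 0 := by
  rw [IsEigenfunction, boundaryCondition_iff]
  exact ⟨fun h => h.2.1.2.2,
    fun h => ⟨hu.1, ⟨hu.2.1, hu.2.2.1, h⟩, hu.exists_ne_zero hm hx0 hx1⟩⟩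

theorem mem_spectrum_iff (hm : ∀ i, 0 < m i) (hx : StrictMono x) (hx0 : ∀ i, 0 < x i)
    (hx1 : ∀ i, x i ≤ 1) (a : Fin 3) {z : ℂ} {u : ℝ → ℂ}
    (hu : IsIVPSolution (massMeasure x m) z u) :
    z ∈ spectrum (massMeasure x m) a ↔ bdryValue a u = 0 := by
  rw [← isEigenfunction_iff hm hx0 hx1 a hu]
  refine ⟨?_, fun h => ⟨u, h⟩⟩
  rintro ⟨f, hf, hbc, ξ, -, hξ⟩
  rw [isEigenfunction_iff hm hx0 hx1 a hu]
  obtain ⟨h0, h1, hb⟩ := (boundaryCondition_iff a f).1 hbc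
  have hfu := eq_smul_of_isSolution hm hx hx0 hu hf h0 h1
  have hC : rightDeriv 2 f 0 ≠ 0 := by
    intro hC
    rw [hfu, hC] at hξ
    simp at hξ
  have hf' := (thirdDerivEq_iff_fwd hm hx0 (-z) f).1 hf
  rw [h0, h1] at hf'
  rw [hf', bdryValue_fwd hx1] at hb
  -- The boundary functional is homogeneous, so its value at `f` is the nonzero factor `rightDeriv 2
  -- f 0` times its value at `u`.
  rw [hu.eq_fwd hm hx0, bdryValue_fwd hx1]
  refine (mul_eq_zero.1 ?_).resolve_left hC
  rw [mul_add, ← hb]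
  have : ∑ i, (m i : ℂ) * (f (x i) * bdryWeight a (x i)) =
      rightDeriv 2 f 0 * ∑ i, (m i : ℂ) * (u (x i) * bdryWeight a (x i)) := by
    rw [Finset.mul_sum]
    refine Finset.sum_congr rfl fun i _ => ?_
    rw [congrFun hfu (x i)]
    ring
  rw [this]
  ring

theorem isAdjointEigenfunction_iff (hm : ∀ i, 0 < m i) (hx0 : ∀ i, 0 < x i)
    (hx1 : ∀ i, x i ≤ 1) (a : Fin 3) {z : ℂ} {u : ℝ → ℂ}
    (hu : IsAdjointIVPSolution (massMeasure x m) a z u) :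
    IsAdjointEigenfunction (massMeasure x m) a z u ↔ u 0 = 0 := by
  rw [IsAdjointEigenfunction, adjointBoundaryCondition_iff]
  refine ⟨fun h => h.2.1.1, fun h => ⟨hu.1, ⟨h, 1, ?_⟩, hu.exists_ne_zero hm hx0 hx1⟩⟩
  simpa using (adjointInitialCondition_iff a u).1 hu.2

theorem mem_adjointSpectrum_iff (hm : ∀ i, 0 < m i) (hx : StrictMono x) (hx0 : ∀ i, 0 < x i)
    (hx1 : ∀ i, x i ≤ 1) (a : Fin 3) {z : ℂ} {u : ℝ → ℂ}
    (hu : IsAdjointIVPSolution (massMeasure x m) a z u) :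
    z ∈ adjointSpectrum (massMeasure x m) a ↔ u 0 = 0 := by
  rw [← isAdjointEigenfunction_iff hm hx0 hx1 a hu]
  refine ⟨?_, fun h => ⟨u, h⟩⟩
  rintro ⟨f, hf, hbc, ξ, -, hξ⟩
  rw [isAdjointEigenfunction_iff hm hx0 hx1 a hu]
  obtain ⟨h0, D, hP, hQ, hR⟩ := (adjointBoundaryCondition_iff a f).1 hbc
  have hf' := (thirdDerivEq_iff_bwd hm hx1 z f).1 hf
  rw [hP, hQ, hR] at hf'
  have hfu := bwd_eq_smul hx (hu.eq_bwd hm hx1) hf'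
  have hD : D ≠ 0 := by
    rintro rfl
    rw [hfu] at hξ
    simp at hξ
  rw [hfu] at h0
  exact (mul_eq_zero.1 h0).resolve_left hD

/-- Lagrange's identity for the two families of solutions of initial value problems. -/
theorem sub_mul_pairing (hm : ∀ i, 0 < m i) (hx0 : ∀ i, 0 < x i) (hx1 : ∀ i, x i ≤ 1)
    {a : Fin 3} {z w : ℂ} {u us : ℝ → ℂ} (hu : IsIVPSolution (massMeasure x m) z u)
    (hus : IsAdjointIVPSolution (massMeasure x m) a w us) :
    (w - z) * pairing (massMeasure x m) u us = (-1) ^ a.val * bdryValue a u - us 0 := by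
  have h1 := hu.eq_fwd hm hx0
  have h2 := hus.eq_bwd hm hx1
  have h := lagrange_identity (x := x) (m := m) (fun k => congrFun h1 (x k))
    (fun k => congrFun h2 (x k))
  have hk : ∑ i, (m i : ℂ) * (us (x i) * ker (x i - 0)) =
      ∑ i, (m i : ℂ) * (us (x i) * ((x i : ℂ) ^ 2 / 2)) :=
    Finset.sum_congr rfl fun i _ => by rw [sub_zero, ker_of_nonneg (hx0 i).le]
  have h20 := congrFun h2 0
  rw [bwd, hk] at h20
  have hb : bdryValue a u = _ := congrArg (bdryValue a) h1 |>.trans (bdryValue_fwd hx1 a _ _ _)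
  rw [pairing_massMeasure hm hx0 hx1, hb, h20, sub_eq_neg_add, h]
  fin_cases a <;> simp [bdryConst, bdryWeight]

/-- Subtracting Lagrange's identity at `w` from that at `z` cancels `us 0`. The difference quotient
is then exactly minus the pairing of `φ z` with `us`, which is continuous in `z`. The point `w` need
not be an eigenvalue. -/
theorem hasDerivAt_bdryValue (hm : ∀ i, 0 < m i) (hx0 : ∀ i, 0 < x i) (hx1 : ∀ i, x i ≤ 1)
    {φ : ℂ → ℝ → ℂ} (hφ : ∀ z, IsIVPSolution (massMeasure x m) z (φ z))
    (hd : ∀ k, Differentiable ℂ fun z => φ z (x k)) {a : Fin 3} {w : ℂ} {us : ℝ → ℂ}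
    (hus : IsAdjointIVPSolution (massMeasure x m) a w us) :
    HasDerivAt (fun z => (-1) ^ a.val * bdryValue a (φ z))
      (-pairing (massMeasure x m) (φ w) us) w := by
  have hcont : Continuous fun z => pairing (massMeasure x m) (φ z) us := by
    simp only [pairing_massMeasure hm hx0 hx1]
    have := fun k => (hd k).continuous
    fun_prop
  rw [hasDerivAt_iff_tendsto_slope]
  refine ((hcont.tendsto w).neg.mono_left nhdsWithin_le_nhds).congr' ?_
  filter_upwards [self_mem_nhdsWithin] with z hz
  have hzw : z - w ≠ 0 := sub_ne_zero.2 hz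
  have h1 := sub_mul_pairing hm hx0 hx1 (hφ z) hus
  have h2 := sub_mul_pairing hm hx0 hx1 (hφ w) hus
  rw [slope_def_field, eq_div_iff hzw]
  linear_combination h1 - h2

theorem differentiable_nodes (hm : ∀ i, 0 < m i) (hx : StrictMono x) (hx0 : ∀ i, 0 < x i)
    {φ : ℂ → ℝ → ℂ} (hφ : ∀ z, IsIVPSolution (massMeasure x m) z (φ z)) (k : Fin n) :
    Differentiable ℂ fun z => φ z (x k) := by
  refine differentiable_of_triangular (· < ·) (S := fun k i : Fin n => -(m i * ker (x k - x i)))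
    (f := fun k => (x k : ℂ) ^ 2 / 2) (v := fun z k => φ z (x k))
    (fun k i hki => by rw [ker_of_nonpos (sub_nonpos.2 (hx.monotone (not_lt.1 hki)))]; ring) ?_ k
  intro z k
  refine (congrFun ((hφ z).eq_fwd hm hx0) (x k)).trans ?_
  rw [fwd, Finset.mul_sum, Finset.mul_sum]
  congr 1
  · ring
  · exact Finset.sum_congr rfl fun i _ => by ring

theorem deriv_bdryValue_ne_zero (hm : ∀ i, 0 < m i) (hx : StrictMono x) (hx0 : ∀ i, 0 < x i)
    (hx1 : ∀ i, x i ≤ 1) {φ : ℂ → ℝ → ℂ} (hφ : ∀ z, IsIVPSolution (massMeasure x m) z (φ z))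
    (a : Fin 3) {z : ℂ} (hz : bdryValue a (φ z) = 0) :
    deriv (fun w => bdryValue a (φ w)) z ≠ 0 := by
  simp only [bdryValue_eq_charFn hm hx0 hx1 hφ] at hz ⊢
  refine deriv_charFn_ne_zero hm hx hx0 hx1 (fun z k => ?_) (differentiable_nodes hm hx hx0 hφ) a hz
  refine (congrFun ((hφ z).eq_fwd hm hx0) (x k)).trans ?_
  rw [fwd, Finset.mul_sum]
  congr 1
  · ring
  · exact Finset.sum_congr rfl fun i _ => by ring

theorem pairing_eq_deriv_bdryValue (hm : ∀ i, 0 < m i) (hx : StrictMono x) (hx0 : ∀ i, 0 < x i)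
    (hx1 : ∀ i, x i ≤ 1) {φ : ℂ → ℝ → ℂ} (hφ : ∀ z, IsIVPSolution (massMeasure x m) z (φ z))
    {a : Fin 3} {z : ℂ} {us : ℝ → ℂ} (hus : IsAdjointIVPSolution (massMeasure x m) a z us) :
    pairing (massMeasure x m) (φ z) us =
      -((-1) ^ a.val * deriv (fun w => bdryValue a (φ w)) z) := by
  have h := (hasDerivAt_bdryValue hm hx0 hx1 hφ (differentiable_nodes hm hx hx0 hφ) hus).deriv
  rw [deriv_const_mul_field] at h
  rw [h, neg_neg]

end

end CubicString

/-! ### Assembly of the theorem -/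

theorem mainTheorem6 (n : ℕ) (x m : Fin n → ℝ)
    (hm : ∀ i, 0 < m i) (hx : StrictMono x) (hx0 : ∀ i, 0 < x i) (hx1 : ∀ i, x i ≤ 1) :
    (∀ z : ℂ, ∃! u : ℝ → ℂ, CubicString.IsIVPSolution (CubicString.massMeasure x m) z u) ∧
    (∀ (a : Fin 3) (z : ℂ),
      ∃! u : ℝ → ℂ, CubicString.IsAdjointIVPSolution (CubicString.massMeasure x m) a z u) ∧
    ∀ (φ : ℂ → ℝ → ℂ) (φs : Fin 3 → ℂ → ℝ → ℂ),
      (∀ z, CubicString.IsIVPSolution (CubicString.massMeasure x m) z (φ z)) →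
      (∀ a z, CubicString.IsAdjointIVPSolution (CubicString.massMeasure x m) a z (φs a z)) →
      -- the spectra coincide
      (∀ a, CubicString.adjointSpectrum (CubicString.massMeasure x m) a =
        CubicString.spectrum (CubicString.massMeasure x m) a) ∧
      -- the initial value solutions at the eigenvalues are eigenfunctions
      (∀ a, ∀ z ∈ CubicString.spectrum (CubicString.massMeasure x m) a,
        CubicString.IsEigenfunction (CubicString.massMeasure x m) a z (φ z) ∧
        CubicString.IsAdjointEigenfunction (CubicString.massMeasure x m) a z (φs a z)) ∧
      -- biorthogonality
      (∀ a, ∀ z ∈ CubicString.spectrum (CubicString.massMeasure x m) a,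
        ∀ w ∈ CubicString.spectrum (CubicString.massMeasure x m) a, z ≠ w →
          CubicString.pairing (CubicString.massMeasure x m) (φ z) (φs a w) = 0) ∧
      -- diagonal pairings
      (∀ z ∈ CubicString.spectrum (CubicString.massMeasure x m) 0,
        CubicString.pairing (CubicString.massMeasure x m) (φ z) (φs 0 z) =
          -deriv (fun w : ℂ => φ w 1) z ∧
        -deriv (fun w : ℂ => φ w 1) z ≠ 0) ∧
      (∀ z ∈ CubicString.spectrum (CubicString.massMeasure x m) 1,
        CubicString.pairing (CubicString.massMeasure x m) (φ z) (φs 1 z) =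
          deriv (fun w : ℂ => CubicString.rightDeriv 1 (φ w) 1) z ∧
        deriv (fun w : ℂ => CubicString.rightDeriv 1 (φ w) 1) z ≠ 0) ∧
      (∀ z ∈ CubicString.spectrum (CubicString.massMeasure x m) 2,
        CubicString.pairing (CubicString.massMeasure x m) (φ z) (φs 2 z) =
          -deriv (fun w : ℂ => CubicString.rightDeriv 2 (φ w) 1) z ∧
        -deriv (fun w : ℂ => CubicString.rightDeriv 2 (φ w) 1) z ≠ 0) := by
  refine ⟨fun z => CubicString.existsUnique_initialValue hm hx hx0 (-z) 0 0 1, fun a z => ?_,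
    fun φ φs hφ hφs => ?_⟩
  · simp only [CubicString.IsAdjointIVPSolution, CubicString.adjointInitialCondition_iff]
    exact CubicString.existsUnique_terminalValue hm hx hx1 z _ _ _
  have hspec := fun a z => CubicString.mem_spectrum_iff hm hx hx0 hx1 a (hφ z)
  have haspec := fun a z => CubicString.mem_adjointSpectrum_iff hm hx hx0 hx1 a (hφs a z)
  have hlag := fun a z w => CubicString.sub_mul_pairing hm hx0 hx1 (hφ z) (hφs a w)
  -- Equal spectral parameters kill the left side of Lagrange's identity, so the two boundary values
  -- agree up to sign.
  have hend : ∀ a z, CubicString.bdryValue a (φ z) = 0 ↔ φs a z 0 = 0 := by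
    intro a z
    have h := hlag a z z
    rw [sub_self, zero_mul, eq_comm, sub_eq_zero] at h
    rw [← h, mul_eq_zero, or_iff_right (pow_ne_zero _ (neg_ne_zero.2 one_ne_zero))]
  have hdiag := fun a z => CubicString.pairing_eq_deriv_bdryValue hm hx hx0 hx1 hφ (hφs a z)
  have hne := fun a z (hz : z ∈ CubicString.spectrum (CubicString.massMeasure x m) a) =>
    CubicString.deriv_bdryValue_ne_zero hm hx hx0 hx1 hφ a ((hspec a z).1 hz)
  refine ⟨fun a => ?_, fun a z hz => ⟨?_, ?_⟩, fun a z hz w hw hzw => ?_, fun z hz => ⟨?_, ?_⟩,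
    fun z hz => ⟨?_, ?_⟩, fun z hz => ⟨?_, ?_⟩⟩
  · ext z
    rw [haspec, hspec, hend]
  · rw [CubicString.isEigenfunction_iff hm hx0 hx1 a (hφ z), ← hspec]
    exact hz
  · rw [CubicString.isAdjointEigenfunction_iff hm hx0 hx1 a (hφs a z), ← hend, ← hspec]
    exact hz
  -- At two eigenvalues both boundary terms vanish, leaving `(w - z)` times the pairing equal to
  -- zero.
  · have h := hlag a z w
    rw [(hspec a z).1 hz, (hend a w).1 ((hspec a w).1 hw), mul_zero, sub_zero] at h
    exact (mul_eq_zero.1 h).resolve_left (sub_ne_zero.2 hzw.symm)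
  · refine (hdiag 0 z).trans ?_
    simp [CubicString.bdryValue]
  · exact neg_ne_zero.2 (hne 0 z hz)
  · refine (hdiag 1 z).trans ?_
    simp [CubicString.bdryValue]
  · exact hne 1 z hz
  · refine (hdiag 2 z).trans ?_
    simp [CubicString.bdryValue]
  · exact neg_ne_zero.2 (hne 2 z hz)
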